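/- For a group $G$ let $\mathrm{rk}(G)\in\mathbb N\cup\{\infty\}$ denote the minimal number of generators of $G$ (with $\mathrm{rk}(G)=\infty$ if $G$ is not finitely generated). A group $G$ is a Howson group if the intersection $H\cap K$ of any two finitely generated subgroups $H,K$ of $G$ is again finitely generated. It is strongly Howson if, for all $h,k\in\mathbb N$, $$\xi_G(h,k):=\sup\{\mathrm{rk}(H\cap K)\mid H,K\le G,\ \mathrm{rk}(H)\le h,\ \mathrm{rk}(K)\le k\}<\infty .$$ Theorem 1.2. Every strongly Howson group is a Howson group. For every integer $n>1$, with $F_n$ the free group of rank $n$, each of the groups $$F_n\times\bigoplus_{m=2}^{\infty}\mathbb Z/m\mathbb Z\qquad\text{and}\qquad F_n\times\mathbb Q/\mathbb Z$$ is a Howson group but is not strongly Howson. Hence the strongly Howson property is strictly stronger than the Howson property. -/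

import Mathlib

open scoped DirectSum

/-- The rank of a group: the minimal number of generators, with value `⊤` exactly when the
group is not finitely generated. -/
noncomputable def rk (G : Type*) [Group G] : ℕ∞ :=
  ⨅ (S : Set G) (_ : Subgroup.closure S = ⊤), S.encard

/-- A group is a Howson group if the intersection of any two finitely generated subgroups is
finitely generated. -/
def IsHowson (G : Type*) [Group G] : Prop :=
  ∀ H K : Subgroup G, H.FG → K.FG → (H ⊓ K).FG

/-- The supremum `ξ_G(h, k)` of the ranks of the intersections `H ∩ K`, over all subgroups `H`, `K`
of `G` of rank at most `h` and at most `k`, respectively. -/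
noncomputable def xi (G : Type*) [Group G] (h k : ℕ) : ℕ∞ :=
  sSup {r : ℕ∞ | ∃ H K : Subgroup G, rk H ≤ h ∧ rk K ≤ k ∧ r = rk (H ⊓ K : Subgroup G)}

/-- A group is strongly Howson if `ξ_G(h, k) < ∞` for all `h` and `k`. -/
def IsStronglyHowson (G : Type*) [Group G] : Prop :=
  ∀ h k : ℕ, xi G h k < ⊤

/-- The direct sum of the finite cyclic groups `ℤ/mℤ` over all `m ≥ 2` (an additive group). -/
abbrev SumZMod : Type := ⨁ m : {m : ℕ // 2 ≤ m}, ZMod m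

/-- The additive group `ℚ/ℤ`. -/
abbrev RatModInt : Type := ℚ ⧸ AddSubgroup.zmultiples (1 : ℚ)

/-!
A group is finitely generated exactly when its rank is finite, so a bound on the ranks of the
intersections gives the Howson property at once.

For the Howson property of `F × T`, where `F` is free of finite rank and `T` is an abelian torsion
group, call a prefix of `L ≤ F × T` a prefix of the reduced word of the `F`-component of an element
of `L`. Both the passage from finite generation to "the prefixes of `L` lie in finitely many cosets
`L r`" (`Subgroup.FG.finitePrefixCosets`) and its converse (`FinitePrefixCosets.fg`) hold as soon as
`L` has finite image in `T`, which is automatic for finitely generated `L` because finitely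
generated torsion abelian groups are finite. In the first direction, reducing a word creates no new
prefixes, as elements of the group, so it suffices to look at the concatenation of the words of the
generators. In the second, reading the word of an element of `L` letter by letter writes it as
a product of elements `r a r'⁻¹ ∈ L` with `a` a letter and `r`, `r'` among the finitely many coset
representatives, followed by one element of a finite set. The coset condition passes to
intersections (`FinitePrefixCosets.inf`), since a nonempty intersection `H r ∩ K s` is a single
coset of `H ∩ K`.

If `T` has elements `t` of arbitrarily large order, `F × T` is not strongly Howson: for distinct
free generators `a`, `b` of `F`, the subgroups `⟨(a, t), (b, 1)⟩` and `⟨(a, 1), (b, 1)⟩` have rank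
at most two, and their intersection contains the conjugates of `(b, 1)` by `(a, t) ^ i`. To see that
many generators are needed, map `a` and `b` into the wreath product of `ℤ/2` by `T`. The
intersection then lands in the base group `T → ℤ/2`, and these conjugates go to the distinct basis
vectors at `t ^ i` for `i < orderOf t`, so the rank is at least `orderOf t`
(`exists_orderOf_le_rk_inf`).
-/

/-! ### Prefixes of words and reduction -/

theorem List.prefix_or_exists_eq_append {β : Type*} {p u v : List β} (h : p <+: u ++ v) :
    p <+: u ∨ ∃ v', p = u ++ v' ∧ v' <+: v := by
  rcases List.prefix_or_prefix_of_prefix h (List.prefix_append u v) with hp | ⟨v', rfl⟩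
  · exact Or.inl hp
  · exact Or.inr ⟨v', rfl, (List.prefix_append_right_inj u).1 h⟩

open FreeGroup in
/-- Reduction of words creates no new prefixes, up to equality in the free group. -/
theorem FreeGroup.Red.exists_prefix_mk_eq {α : Type*} {L₁ L₂ : List (α × Bool)}
    (h : Red L₁ L₂) {p : List (α × Bool)} (hp : p <+: L₂) :
    ∃ q, q <+: L₁ ∧ FreeGroup.mk q = FreeGroup.mk p := by
  induction h generalizing p with
  | refl => exact ⟨p, hp, rfl⟩
  | tail _ hstep ih =>
    obtain @⟨u, v, x, b⟩ := hstep
    rcases List.prefix_or_exists_eq_append hp with hpu | ⟨v', rfl, hv'⟩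
    · exact ih (hpu.trans (List.prefix_append _ _))
    · obtain ⟨q, hq, hqp⟩ := ih (p := u ++ (x, b) :: (x, !b) :: v') (by
        simpa using hv')
      exact ⟨q, hq, hqp.trans (Quot.sound Red.Step.not)⟩

/-! ### The Howson property of products of free and torsion groups -/

/-- The elements `(p, 1)`, for `p` a prefix of the reduced word of the free component of an element
of `L`, lie in finitely many right cosets of `L`. The set `R` contains representatives of these
cosets. For trivial `T` this says that `L` is a quasiconvex subgroup of the free group. -/
def FinitePrefixCosets {α T : Type*} [DecidableEq α] [Group T]
    (L : Subgroup (FreeGroup α × T)) : Prop :=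
  ∃ R : Set (FreeGroup α × T), R.Finite ∧ ∀ g ∈ L, ∀ p, p <+: g.1.toWord →
    ∃ l ∈ L, ∃ r ∈ R, l * r = (FreeGroup.mk p, 1)

/-- A nonempty intersection of a right coset of `H` and a right coset of `K` is a right coset of
`H ⊓ K`, so there are finitely many of them. -/
theorem FinitePrefixCosets.inf {α T : Type*} [DecidableEq α] [Group T]
    {H K : Subgroup (FreeGroup α × T)} (hH : FinitePrefixCosets H) (hK : FinitePrefixCosets K) :
    FinitePrefixCosets (H ⊓ K) := by
  classical
  obtain ⟨R, hR, hHR⟩ := hH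
  obtain ⟨S, hS, hKS⟩ := hK
  -- `x (r, s)` is an element of `H r ∩ K s` whenever there is one; the value `1` is immaterial.
  let x : (FreeGroup α × T) × (FreeGroup α × T) → FreeGroup α × T := fun rs ↦
    if h : ∃ y, y * rs.1⁻¹ ∈ H ∧ y * rs.2⁻¹ ∈ K then h.choose else 1
  refine ⟨x '' (R ×ˢ S), (hR.prod hS).image _, fun g hg p hp ↦ ?_⟩
  obtain ⟨l, hl, r, hr, hlr⟩ := hHR g hg.1 p hp
  obtain ⟨k, hk, s, hs, hks⟩ := hKS g hg.2 p hp
  have hex : ∃ y, y * r⁻¹ ∈ H ∧ y * s⁻¹ ∈ K :=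
    ⟨(FreeGroup.mk p, 1), by rwa [← hlr, mul_inv_cancel_right],
      by rwa [← hks, mul_inv_cancel_right]⟩
  have hx : x (r, s) * r⁻¹ ∈ H ∧ x (r, s) * s⁻¹ ∈ K := by
    simp only [x, dif_pos hex]
    exact hex.choose_spec
  refine ⟨(FreeGroup.mk p, 1) * (x (r, s))⁻¹, ⟨?_, ?_⟩, x (r, s),
    Set.mem_image_of_mem _ ⟨hr, hs⟩, by simp⟩
  · simpa [← hlr, mul_assoc] using H.mul_mem hl (H.inv_mem hx.1)
  · simpa [← hks, mul_assoc] using K.mul_mem hk (K.inv_mem hx.2)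

theorem Subgroup.FG.finite_map_snd {F T : Type*} [Group F] [CommGroup T]
    (hT : IsMulTorsion T) {H : Subgroup (F × T)} (hH : H.FG) :
    Finite (H.map (MonoidHom.snd F T)) := by
  obtain ⟨S, hS, hfin⟩ := (Subgroup.fg_iff H).1 hH
  have : Group.FG (H.map (MonoidHom.snd F T)) := (Group.fg_iff_subgroup_fg _).2
    ((Subgroup.fg_iff _).2 ⟨_, by rw [← MonoidHom.map_closure, hS], hfin.image _⟩)
  exact CommGroup.finite_of_fg_isMulTorsion _ (hT.subgroup _)

/-- The set of elements whose prefixes lie in finitely many given cosets of `H` contains the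
generators of `H` and is closed under products and inverses. -/
theorem Subgroup.FG.finitePrefixCosets {α T : Type*} [DecidableEq α] [CommGroup T]
    (hT : IsMulTorsion T) {H : Subgroup (FreeGroup α × T)} (hH : H.FG) :
    FinitePrefixCosets H := by
  have hfinA := hH.finite_map_snd hT
  obtain ⟨S, hS, hfin⟩ := (Subgroup.fg_iff H).1 hH
  set A := H.map (MonoidHom.snd (FreeGroup α) T) with hA
  have hSH : S ⊆ H := hS ▸ Subgroup.subset_closure
  have hmemA : ∀ g ∈ H, g.2 ∈ A := fun g hg ↦ ⟨g, hg, rfl⟩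
  let P : Set (FreeGroup α) := insert 1 (⋃ s ∈ S, FreeGroup.mk '' {p | p ∈ s.1.toWord.inits})
  have hP : P.Finite := (hfin.biUnion fun s _ ↦ (List.finite_toSet _).image _).insert 1
  -- The representatives `P ×ˢ A` are stable under multiplication by `A`, which absorbs the torsion
  -- components of the elements of `H` met along the way.
  have key : ∀ g ∈ H, ∀ p, p <+: g.1.toWord →
      ∃ l ∈ H, ∃ r ∈ P ×ˢ (A : Set T), l * r = (FreeGroup.mk p, 1) := by
    intro g hg
    rw [← hS] at hg
    induction hg using Subgroup.closure_induction with
    | mem s hs =>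
      intro p hp
      refine ⟨1, one_mem _, (FreeGroup.mk p, 1), ⟨?_, one_mem _⟩, one_mul _⟩
      exact Or.inr (Set.mem_biUnion hs ⟨p, (List.mem_inits _ _).2 hp, rfl⟩)
    | one =>
      intro p hp
      obtain rfl : p = [] := by simpa using hp
      exact ⟨1, one_mem _, 1, ⟨Or.inl rfl, one_mem _⟩, one_mul _⟩
    | mul g h hg _ ihg ihh =>
      rw [hS] at hg
      intro p hp
      have hred : FreeGroup.Red (g.1.toWord ++ h.1.toWord) (g * h).1.toWord := by
        rw [Prod.fst_mul, FreeGroup.toWord_mul]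
        exact FreeGroup.reduce.red
      obtain ⟨q, hq, hqp⟩ := hred.exists_prefix_mk_eq hp
      rw [← hqp]
      rcases List.prefix_or_exists_eq_append hq with hq | ⟨q', rfl, hq'⟩
      · exact ihg q hq
      · obtain ⟨l, hl, r, hr, hlr⟩ := ihh q' hq'
        refine ⟨g * l, mul_mem hg hl, r * (1, g.2⁻¹),
          ⟨by simpa using hr.1, mul_mem hr.2 (inv_mem (hmemA g hg))⟩, ?_⟩
        rw [mul_assoc, ← mul_assoc l, hlr, ← FreeGroup.mul_mk, FreeGroup.mk_toWord]
        ext <;> simp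
    | inv g hg ih =>
      rw [hS] at hg
      intro p hp
      -- The inverse of `p` is a suffix of the word of `g`; if `q` is the complementary prefix,
      -- then `p = g⁻¹ * q` in the free group.
      rw [Prod.fst_inv, FreeGroup.toWord_inv] at hp
      obtain ⟨s, hs⟩ := hp
      have hw : g.1.toWord = FreeGroup.invRev s ++ FreeGroup.invRev p := by
        rw [← FreeGroup.invRev_append, hs, FreeGroup.invRev_invRev]
      obtain ⟨l, hl, r, hr, hlr⟩ := ih _ ⟨_, hw.symm⟩
      have hgp : FreeGroup.mk p = g.1⁻¹ * FreeGroup.mk (FreeGroup.invRev s) := by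
        rw [← FreeGroup.mk_toWord (x := g.1), hw, ← FreeGroup.mul_mk, ← FreeGroup.inv_mk,
          ← FreeGroup.inv_mk]
        group
      refine ⟨g⁻¹ * l, mul_mem (inv_mem hg) hl, r * (1, g.2),
        ⟨by simpa using hr.1, mul_mem hr.2 (hmemA g hg)⟩, ?_⟩
      rw [mul_assoc, ← mul_assoc l, hlr, hgp]
      ext <;> simp
  exact ⟨_, hP.prod (Set.toFinite (A : Set T)), key⟩

/-- Schreier's argument, with the finitely many cosets met by prefixes in place of all cosets. -/
theorem FinitePrefixCosets.fg {α T : Type*} [Finite α] [DecidableEq α] [Group T]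
    {L : Subgroup (FreeGroup α × T)} (hL : FinitePrefixCosets L)
    (hfin : Finite (L.map (MonoidHom.snd (FreeGroup α) T))) : L.FG := by
  obtain ⟨R, hR, hLR⟩ := hL
  -- The empty prefix starts the induction with the representative `1`, which need not be in `R`.
  let R' := insert 1 R
  have hR' : R'.Finite := hR.insert 1
  let A := L.map (MonoidHom.snd (FreeGroup α) T)
  -- The Schreier generators `r * a * r'⁻¹`, and the elements comparing the end of a word of `L`
  -- with the corresponding element of `L`.
  let X : Set (FreeGroup α × T) :=
    (fun z : (FreeGroup α × T) × (α × Bool) × (FreeGroup α × T) ↦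
      z.1 * (FreeGroup.mk [z.2.1], 1) * z.2.2⁻¹) '' (R' ×ˢ Set.univ ×ˢ R')
  let Y : Set (FreeGroup α × T) :=
    (fun z : (FreeGroup α × T) × T ↦ z.1 * (1, z.2)) '' (R' ×ˢ (A : Set T))
  have hX : X.Finite := (hR'.prod (Set.finite_univ.prod hR')).image _
  have hY : Y.Finite := (hR'.prod (Set.toFinite (A : Set T))).image _
  let M := Subgroup.closure ((X ∪ Y) ∩ L)
  have hML : M ≤ L := (Subgroup.closure_le _).2 Set.inter_subset_right
  have key : ∀ g ∈ L, ∀ p, p <+: g.1.toWord →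
      ∃ m ∈ M, ∃ r ∈ R', m * r = (FreeGroup.mk p, 1) := by
    intro g hg p
    induction p using List.reverseRecOn with
    | nil => exact fun _ ↦ ⟨1, one_mem _, 1, Or.inl rfl, one_mul _⟩
    | append_singleton p a ih =>
      intro hp
      obtain ⟨m, hm, r, hr, hmr⟩ := ih ((List.prefix_append _ _).trans hp)
      obtain ⟨l, hl, s, hs, hls⟩ := hLR g hg _ hp
      have hstep : m * r * (FreeGroup.mk [a], 1) = l * s := by
        rw [hmr, hls, ← FreeGroup.mul_mk]; simp
      have hx : r * (FreeGroup.mk [a], 1) * s⁻¹ = m⁻¹ * l := by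
        rw [mul_inv_eq_iff_eq_mul, mul_assoc, ← hstep]; group
      have hxM : r * (FreeGroup.mk [a], 1) * s⁻¹ ∈ M := by
        refine Subgroup.subset_closure ⟨Or.inl ⟨(r, a, s), ⟨hr, trivial, Or.inr hs⟩, rfl⟩, ?_⟩
        rw [hx]
        exact mul_mem (inv_mem (hML hm)) hl
      refine ⟨_, mul_mem hm hxM, s, Or.inr hs, ?_⟩
      rw [← hls, ← hstep]; group
  refine (Subgroup.fg_iff L).2 ⟨_, le_antisymm hML fun g hg ↦ ?_, (hX.union hY).inter_of_left _⟩
  obtain ⟨m, hm, r, hr, hmr⟩ := key g hg _ (List.prefix_refl _)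
  have hg' : g = m * (r * (1, g.2)) := by
    rw [← mul_assoc, hmr, FreeGroup.mk_toWord]; ext <;> simp
  have hy : r * (1, g.2) ∈ M := by
    refine Subgroup.subset_closure ⟨Or.inr ⟨(r, g.2), ⟨hr, g, hg, rfl⟩, rfl⟩, ?_⟩
    rw [← inv_mul_eq_iff_eq_mul] at hg'
    exact hg' ▸ mul_mem (inv_mem (hML hm)) hg
  exact hg' ▸ mul_mem hm hy

/-- For trivial `T` this is Howson's theorem. -/
theorem isHowson_freeGroup_prod {α T : Type*} [Finite α] [CommGroup T]
    (hT : IsMulTorsion T) : IsHowson (FreeGroup α × T) := by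
  classical
  intro H K hH hK
  refine ((hH.finitePrefixCosets hT).inf (hK.finitePrefixCosets hT)).fg ?_
  have := hH.finite_map_snd hT
  exact Finite.Set.subset (H.map (MonoidHom.snd _ T) : Set T)
    (Subgroup.map_mono (inf_le_left : H ⊓ K ≤ H))

/-! ### The rank of a group -/

theorem rk_lt_top_iff {G : Type*} [Group G] : rk G < ⊤ ↔ Group.FG G := by
  simp only [rk, iInf_lt_iff, Set.encard_lt_top_iff, Group.fg_iff, exists_prop]

theorem rk_closure_le {G : Type*} [Group G] (S : Set G) :
    rk (Subgroup.closure S) ≤ S.encard := by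
  refine (iInf₂_le (Subtype.val ⁻¹' S) (Subgroup.closure_closure_coe_preimage (k := S))).trans ?_
  exact (Set.encard_preimage_of_injective_subset_range Subtype.val_injective
    (by simp)).le

theorem rk_inf_le_xi {G : Type*} [Group G] {H K : Subgroup G} {h k : ℕ}
    (hH : rk H ≤ h) (hK : rk K ≤ k) : rk (H ⊓ K : Subgroup G) ≤ xi G h k :=
  le_sSup ⟨H, K, hH, hK, rfl⟩

theorem IsStronglyHowson.isHowson {G : Type*} [Group G] (hG : IsStronglyHowson G) :
    IsHowson G := by
  intro H K hH hK
  obtain ⟨h, hh⟩ := ENat.ne_top_iff_exists.1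
    (rk_lt_top_iff.2 ((Group.fg_iff_subgroup_fg H).2 hH)).ne
  obtain ⟨k, hk⟩ := ENat.ne_top_iff_exists.1
    (rk_lt_top_iff.2 ((Group.fg_iff_subgroup_fg K).2 hK)).ne
  rw [← Group.fg_iff_subgroup_fg, ← rk_lt_top_iff]
  exact (rk_inf_le_xi hh.ge hk.ge).trans_lt (hG h k)

/-- A homomorphism to a vector space bounds the rank from below by the dimension of the span of its
image. -/
theorem le_rk_of_linearIndependent {k V G : Type*} [Field k] [AddCommGroup V] [Module k V]
    [Group G] (f : G →* Multiplicative V) {m : ℕ} (v : Fin m → V) (hv : LinearIndependent k v)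
    (hf : ∀ i, ∃ g, f g = Multiplicative.ofAdd (v i)) : (m : ℕ∞) ≤ rk G := by
  refine le_iInf₂ fun S hS ↦ ?_
  rcases S.finite_or_infinite with hfin | hinf
  swap
  · simp [hinf.encard_eq]
  let W : Submodule k V := Submodule.span k ((fun g ↦ (f g).toAdd) '' S)
  have hW : ∀ g, (f g).toAdd ∈ W := by
    intro g
    have hg : g ∈ Subgroup.closure S := hS ▸ Subgroup.mem_top g
    induction hg using Subgroup.closure_induction with
    | mem s hs => exact Submodule.subset_span ⟨s, hs, rfl⟩
    | one => simp
    | mul a b _ _ ha hb => simpa using add_mem ha hb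
    | inv a _ ha => simpa using ha
  have hvW : Submodule.span k (Set.range v) ≤ W := by
    rw [Submodule.span_le]
    rintro _ ⟨i, rfl⟩
    obtain ⟨g, hg⟩ := hf i
    simpa [hg] using hW g
  have hfin' : ((fun g ↦ (f g).toAdd) '' S).Finite := hfin.image _
  have : Fintype ((fun g ↦ (f g).toAdd) '' S) := hfin'.fintype
  have : Module.Finite k W := Module.Finite.span_of_finite k hfin'
  have h1 := Submodule.finrank_mono hvW
  rw [finrank_span_eq_card hv, Fintype.card_fin] at h1
  have h2 := h1.trans (finrank_span_le_card (R := k) ((fun g ↦ (f g).toAdd) '' S))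
  rw [Set.toFinset_card, ← Nat.card_eq_fintype_card, Nat.card_coe_set_eq] at h2
  calc (m : ℕ∞) ≤ (((fun g ↦ (f g).toAdd) '' S).ncard : ℕ∞) := by exact_mod_cast h2
    _ = ((fun g ↦ (f g).toAdd) '' S).encard := hfin'.cast_ncard_eq
    _ ≤ S.encard := Set.encard_image_le _ _

/-! ### Intersections of large rank -/

/-- The subgroups are `⟨(a, t), (b, 1)⟩` and `⟨(a, 1), (b, 1)⟩`. -/
theorem exists_orderOf_le_rk_inf {α T : Type*} [Group T] {a b : α} (hab : a ≠ b) (t : T)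
    {m : ℕ} (hm : m ≤ orderOf t) :
    ∃ H K : Subgroup (FreeGroup α × T), rk H ≤ (2 : ℕ) ∧ rk K ≤ (2 : ℕ) ∧
      (m : ℕ∞) ≤ rk (H ⊓ K : Subgroup (FreeGroup α × T)) := by
  classical
  let D := Multiplicative (ZMod 2)
  let x : FreeGroup α × T := (FreeGroup.of a, t)
  let x' : FreeGroup α × T := (FreeGroup.of a, 1)
  let y : FreeGroup α × T := (FreeGroup.of b, 1)
  let H := Subgroup.closure {x, y}
  let K := Subgroup.closure {x', y}
  have hrk : ∀ u v : FreeGroup α × T, rk (Subgroup.closure {u, v}) ≤ (2 : ℕ) := fun u v ↦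
    (rk_closure_le _).trans
    ((Set.encard_insert_le _ _).trans (by rw [Set.encard_singleton]; rfl))
  refine ⟨H, K, hrk _ _, hrk _ _, ?_⟩
  -- `ρ` sends `a` to `t` and `b` to the generator of the factor of the base group at `1`.
  let ρ : FreeGroup α →* D ≀ᵣ T := FreeGroup.lift fun c ↦
    if c = a then ⟨1, t⟩ else if c = b then ⟨Pi.mulSingle 1 (Multiplicative.ofAdd 1), 1⟩ else 1
  have hρa : ρ (FreeGroup.of a) = ⟨1, t⟩ := by simp [ρ]
  have hρb : ρ (FreeGroup.of b) = ⟨Pi.mulSingle 1 (Multiplicative.ofAdd 1), 1⟩ := by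
    simp [ρ, hab.symm]
  have hK : ∀ g ∈ K, g.2 = 1 := by
    have : K ≤ (MonoidHom.snd (FreeGroup α) T).ker := by
      rw [Subgroup.closure_le]
      rintro _ (rfl | rfl) <;> rfl
    exact fun g hg ↦ this hg
  have hH : ∀ g ∈ H, (ρ g.1).right = g.2 := by
    have : H ≤ (RegularWreathProduct.rightHom.comp (ρ.comp (MonoidHom.fst _ T))).eqLocus
        (MonoidHom.snd (FreeGroup α) T) := by
      rw [Subgroup.closure_le]
      rintro _ (rfl | rfl)
      · exact congrArg RegularWreathProduct.right hρa
      · exact congrArg RegularWreathProduct.right hρb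
    exact fun g hg ↦ this hg
  -- On `H ⊓ K` the `T`-component of `ρ` is trivial, so its base component is a homomorphism.
  let f : (H ⊓ K : Subgroup (FreeGroup α × T)) →* Multiplicative (T → ZMod 2) :=
    { toFun := fun g ↦ Multiplicative.ofAdd fun s ↦ ((ρ g.1.1).left s).toAdd
      map_one' := by simp; rfl
      map_mul' := by
        intro g h
        have hg : (ρ g.1.1).right = 1 := (hH _ g.2.1).trans (hK _ g.2.2)
        apply Multiplicative.toAdd.injective
        funext s
        simp only [Subgroup.coe_mul, Prod.fst_mul, map_mul, RegularWreathProduct.mul_left, hg,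
          inv_one, one_mul]
        rfl }
  refine le_rk_of_linearIndependent (k := ZMod 2) f
    (fun i : Fin m ↦ Pi.single (t ^ (i : ℕ)) 1) ?_ fun i ↦ ?_
  · refine (Pi.linearIndependent_single_one T (ZMod 2)).comp (fun i : Fin m ↦ t ^ (i : ℕ)) ?_
    intro i j hij
    exact Fin.ext (pow_injOn_Iio_orderOf (i.2.trans_le hm) (j.2.trans_le hm) hij)
  · have hxH : x ∈ H := Subgroup.subset_closure (by simp)
    have hyH : y ∈ H := Subgroup.subset_closure (by simp)
    have hxK : x' ∈ K := Subgroup.subset_closure (by simp)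
    have hyK : y ∈ K := Subgroup.subset_closure (by simp)
    -- The torsion components cancel in the conjugate, so `t` may be replaced by `1`.
    have heq : x ^ (i : ℕ) * y * (x ^ (i : ℕ))⁻¹ = x' ^ (i : ℕ) * y * (x' ^ (i : ℕ))⁻¹ := by
      ext <;> simp [x, x', y]
    have hmemH : x ^ (i : ℕ) * y * (x ^ (i : ℕ))⁻¹ ∈ H :=
      mul_mem (mul_mem (pow_mem hxH _) hyH) (inv_mem (pow_mem hxH _))
    have hmemK : x ^ (i : ℕ) * y * (x ^ (i : ℕ))⁻¹ ∈ K := by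
      rw [heq]
      exact mul_mem (mul_mem (pow_mem hxK _) hyK) (inv_mem (pow_mem hxK _))
    refine ⟨⟨x ^ (i : ℕ) * y * (x ^ (i : ℕ))⁻¹, hmemH, hmemK⟩, ?_⟩
    have hpow : ∀ j : ℕ, (⟨1, t⟩ : D ≀ᵣ T) ^ j = ⟨1, t ^ j⟩ := fun j ↦
      (map_pow (RegularWreathProduct.inl (D := D)) t j).symm
    apply Multiplicative.toAdd.injective
    funext s
    by_cases hs : s = t ^ (i : ℕ)
    · subst hs
      simp [f, x, y, hρa, hρb, hpow]
    · have : (t ^ (i : ℕ))⁻¹ * s ≠ 1 := by rwa [Ne, inv_mul_eq_one, eq_comm]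
      simp [f, x, y, hρa, hρb, hpow, hs, this]

theorem not_isStronglyHowson_freeGroup_prod {α T : Type*} [Nontrivial α] [Group T]
    (hT : ∀ m : ℕ, ∃ t : T, m ≤ orderOf t) : ¬ IsStronglyHowson (FreeGroup α × T) := by
  intro h
  obtain ⟨a, b, hab⟩ := exists_pair_ne α
  obtain ⟨N, hN⟩ := ENat.ne_top_iff_exists.1 (h 2 2).ne
  obtain ⟨t, ht⟩ := hT (N + 1)
  obtain ⟨H, K, hH, hK, hle⟩ := exists_orderOf_le_rk_inf hab t ht
  have := hle.trans ((rk_inf_le_xi hH hK).trans hN.ge)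
  exact absurd (Nat.cast_le.1 this) (by omega)

/-! ### The two torsion groups -/

theorem isMulTorsion_multiplicative_sumZMod : IsMulTorsion (Multiplicative SumZMod) := by
  suffices h : ∀ x : SumZMod, IsOfFinAddOrder x from
    fun x ↦ h x.toAdd
  intro x
  induction x using DirectSum.induction_on with
  | zero => exact IsOfFinAddOrder.zero
  | of i a =>
    have : NeZero i.1 := ⟨by have := i.2; omega⟩
    exact (DirectSum.of (fun m : {m : ℕ // 2 ≤ m} ↦ ZMod m) i).isOfFinAddOrder
      (isOfFinAddOrder_of_finite a)
  | add x y hx hy => exact hx.add hy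

theorem exists_le_orderOf_sumZMod (m : ℕ) : ∃ t : Multiplicative SumZMod, m ≤ orderOf t := by
  let i : {m : ℕ // 2 ≤ m} := ⟨m + 2, by omega⟩
  refine ⟨Multiplicative.ofAdd (DirectSum.of (fun m : {m : ℕ // 2 ≤ m} ↦ ZMod m) i 1), ?_⟩
  rw [orderOf_ofAdd_eq_addOrderOf,
    addOrderOf_injective _ (DirectSum.of_injective (β := fun m : {m : ℕ // 2 ≤ m} ↦ ZMod m) i),
    ZMod.addOrderOf_one]
  exact Nat.le_add_right m 2

theorem addOrderOf_coe_ratModInt (q : ℚ) : addOrderOf (q : RatModInt) = q.den := by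
  have := AddCircle.addOrderOf_coe_rat (p := (1 : ℚ)) (q := q)
  rwa [mul_one, Rat.cast_id] at this

theorem isMulTorsion_multiplicative_ratModInt : IsMulTorsion (Multiplicative RatModInt) := by
  suffices h : ∀ x : RatModInt, IsOfFinAddOrder x from
    fun x ↦ h x.toAdd
  intro x
  induction x using QuotientAddGroup.induction_on with
  | H q => exact addOrderOf_pos_iff.1 ((addOrderOf_coe_ratModInt q).symm ▸ q.pos)

theorem exists_le_orderOf_ratModInt (m : ℕ) : ∃ t : Multiplicative RatModInt, m ≤ orderOf t := by
  refine ⟨Multiplicative.ofAdd (((m + 1 : ℕ) : ℚ)⁻¹ : ℚ), ?_⟩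
  rw [orderOf_ofAdd_eq_addOrderOf, addOrderOf_coe_ratModInt,
    Rat.inv_natCast_den_of_pos (Nat.succ_pos m)]
  exact Nat.le_succ m

theorem theorem1p2 :
    (∀ (G : Type*) [Group G], IsStronglyHowson G → IsHowson G) ∧
    ∀ n : ℕ, 1 < n →
      (IsHowson (FreeGroup (Fin n) × Multiplicative SumZMod) ∧
        ¬ IsStronglyHowson (FreeGroup (Fin n) × Multiplicative SumZMod)) ∧
      (IsHowson (FreeGroup (Fin n) × Multiplicative RatModInt) ∧
        ¬ IsStronglyHowson (FreeGroup (Fin n) × Multiplicative RatModInt)) := by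
  refine ⟨fun G _ hG ↦ hG.isHowson, fun n hn ↦ ?_⟩
  have : Nontrivial (Fin n) := Fin.nontrivial_iff_two_le.2 hn
  exact ⟨⟨isHowson_freeGroup_prod isMulTorsion_multiplicative_sumZMod,
      not_isStronglyHowson_freeGroup_prod exists_le_orderOf_sumZMod⟩,
    isHowson_freeGroup_prod isMulTorsion_multiplicative_ratModInt,
      not_isStronglyHowson_freeGroup_prod exists_le_orderOf_ratModInt⟩
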